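/- Let $n\ge 0$ and let $w_1,\dots,w_{2n}$ be Hermitian operators on a complex Hilbert space of dimension $2^n$ with $w_jw_k+w_kw_j=2\delta_{jk}\mathbb 1$. Let $\mathbf H$ be a $2n\times 2n$ Hermitian and antisymmetric (hence purely imaginary) matrix, let $l_{\mu}=(l_{\mu,1},\dots,l_{\mu,2n})\in\mathbb C^{2n}$ for $\mu$ in a finite index set, and put $$H=\sum_{j,k}\mathbf H_{jk}w_jw_k,\qquad L_\mu=\sum_j l_{\mu,j}w_j,\qquad \hat{\mathcal L}\rho=-i[H,\rho]+\sum_\mu\bigl(2L_\mu\rho L_\mu^\dagger-\{L_\mu^\dagger L_\mu,\rho\}\bigr).$$ Let $M_{jk}=\sum_\mu l_{\mu,j}\overline{l_{\mu,k}}$, $M_r=\tfrac12(M+\overline M)$, $M_i=\tfrac1{2i}(M-\overline M)$ and $X=-2i\mathbf H+2M_r$. Assume that every eigenvalue of $X$ has strictly positive real part. Then: (a) there is exactly one operator $\rho_{\rm NESS}$ with $\hat{\mathcal L}\rho_{\rm NESS}=0$ and $\mathrm{tr}\,\rho_{\rm NESS}=1$ (the non-equilibrium steady state); (b) the Lyapunov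 equation $X^TZ+ZX=M_i$ has exactly one solution $Z\in\mathbb C^{2n\times 2n}$, and $Z$ is real and antisymmetric; (c) for all $j,k\in\{1,\dots,2n\}$, $$\mathrm{tr}\,(w_jw_k\,\rho_{\rm NESS})=\delta_{jk}-4i\,Z_{jk}.$$ -/

import Mathlib

noncomputable section

namespace QuadraticLindblad

open Matrix

/-- A family of `2n` Hermitian operators `w_j` with `{w_j, w_k} = 2 δ_{jk}`
(written as matrices in an orthonormal basis of the Hilbert space). -/
def IsMajoranaFamily {ι : Type*} [Fintype ι] [DecidableEq ι] {n : ℕ}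
    (w : Fin (2 * n) → Matrix ι ι ℂ) : Prop :=
  (∀ j, (w j).IsHermitian) ∧
    ∀ j k, w j * w k + w k * w j = if j = k then (2 : ℂ) • (1 : Matrix ι ι ℂ) else 0

/-- The quadratic Hamiltonian `∑ w_j H_{jk} w_k`. -/
def hamiltonian {ι : Type*} [Fintype ι] {n : ℕ} (w : Fin (2 * n) → Matrix ι ι ℂ)
    (H : Matrix (Fin (2 * n)) (Fin (2 * n)) ℂ) : Matrix ι ι ℂ :=
  ∑ j, ∑ k, H j k • (w j * w k)

/-- The linear Lindblad operator `∑ l_j w_j`. -/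
def lindbladOp {ι : Type*} {n : ℕ} (w : Fin (2 * n) → Matrix ι ι ℂ)
    (l : Fin (2 * n) → ℂ) : Matrix ι ι ℂ :=
  ∑ j, l j • w j

/-- The Lindblad generator
`ρ ↦ -i [h, ρ] + ∑_μ (2 L_μ ρ L_μ† - {L_μ† L_μ, ρ})`. -/
def liouvillean {ι κ : Type*} [Fintype ι] [Fintype κ] (h : Matrix ι ι ℂ)
    (L : κ → Matrix ι ι ℂ) (ρ : Matrix ι ι ℂ) : Matrix ι ι ℂ :=
  -Complex.I • (h * ρ - ρ * h) +
    ∑ μ, ((2 : ℂ) • (L μ * ρ * (L μ)ᴴ) - ((L μ)ᴴ * L μ * ρ + ρ * ((L μ)ᴴ * L μ)))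

/-- A non-equilibrium steady state: a zero-eigenvalue eigenvector of the generator, normalised to
unit trace. -/
def IsNESS {ι κ : Type*} [Fintype ι] [Fintype κ] {n : ℕ} (w : Fin (2 * n) → Matrix ι ι ℂ)
    (H : Matrix (Fin (2 * n)) (Fin (2 * n)) ℂ) (l : κ → Fin (2 * n) → ℂ)
    (ρ : Matrix ι ι ℂ) : Prop :=
  liouvillean (hamiltonian w H) (fun μ => lindbladOp w (l μ)) ρ = 0 ∧ ρ.trace = 1

/-- The bath matrix `M_{jk} = ∑_μ l_{μ,j} conj(l_{μ,k})`. -/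
def bathMatrix {κ : Type*} [Fintype κ] {n : ℕ} (l : κ → Fin (2 * n) → ℂ) :
    Matrix (Fin (2 * n)) (Fin (2 * n)) ℂ :=
  Matrix.of fun j k => ∑ μ, l μ j * star (l μ k)

/-- The real part `(M + conj M) / 2` of the bath matrix. -/
def bathRe {κ : Type*} [Fintype κ] {n : ℕ} (l : κ → Fin (2 * n) → ℂ) :
    Matrix (Fin (2 * n)) (Fin (2 * n)) ℂ :=
  (1 / 2 : ℂ) • (bathMatrix l + (bathMatrix l).map star)

/-- The imaginary part `(M - conj M) / (2i)` of the bath matrix. -/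
def bathIm {κ : Type*} [Fintype κ] {n : ℕ} (l : κ → Fin (2 * n) → ℂ) :
    Matrix (Fin (2 * n)) (Fin (2 * n)) ℂ :=
  (1 / (2 * Complex.I)) • (bathMatrix l - (bathMatrix l).map star)

/-- The matrix `X = -2 i H + 2 M_r`. -/
def rapidityMatrix {κ : Type*} [Fintype κ] {n : ℕ}
    (H : Matrix (Fin (2 * n)) (Fin (2 * n)) ℂ) (l : κ → Fin (2 * n) → ℂ) :
    Matrix (Fin (2 * n)) (Fin (2 * n)) ℂ :=
  (-2 * Complex.I) • H + (2 : ℂ) • bathRe l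

/-- `Z` solves the Lyapunov equation `Xᵀ Z + Z X = M_i`. -/
def IsLyapunovSolution {κ : Type*} [Fintype κ] {n : ℕ}
    (H : Matrix (Fin (2 * n)) (Fin (2 * n)) ℂ) (l : κ → Fin (2 * n) → ℂ)
    (Z : Matrix (Fin (2 * n)) (Fin (2 * n)) ℂ) : Prop :=
  (rapidityMatrix H l)ᵀ * Z + Z * rapidityMatrix H l = bathIm l

end QuadraticLindblad

end

/-! Everything is tested on monomials in the `w_j` in the Heisenberg picture. The adjoint generator
sends a monomial of length `m` to `-2` times the sum over its slots of the action of `X`, plus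
shorter monomials of the same parity (`heisenberg_monomial`). This leading part is a Kronecker sum
of `m` copies of `X`; its eigenvalues are sums of `m` eigenvalues of `X`, so it is injective for `m
≥ 1` (`eq_zero_of_sum_slotMap_eq_zero`). By induction on length, a traceless operator in the kernel
of the generator pairs to zero with all even monomials. Odd monomials are first written as an odd
monomial times the parity operator, which restores the sign needed for the cancellation of
top-degree terms. Since monomials span all matrices, the kernel contains no nonzero traceless
operator; as the generator has traceless image, a dimension count then gives the steady state and
its uniqueness.

The case `m = 2` is unique solvability of the Lyapunov equation, which also forces the symmetries of
`Z`. Stationarity of the two-point functions is a closed linear equation, and it is that Lyapunov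
equation up to an affine change of variable. -/

namespace QuadraticLindblad

open Matrix

/-! ### Kronecker sums and their spectra -/

section CommutingOperators

/-- If all eigenvalues of two commuting operators lie in the open right half plane, so do those of
their sum. -/
theorem re_pos_of_hasEigenvalue_add {V : Type*} [AddCommGroup V] [Module ℂ V]
    [FiniteDimensional ℂ V] {A B : Module.End ℂ V} (hAB : Commute A B)
    (hA : ∀ z, A.HasEigenvalue z → 0 < z.re) (hB : ∀ z, B.HasEigenvalue z → 0 < z.re)
    {z : ℂ} (hz : (A + B).HasEigenvalue z) : 0 < z.re := by
  have hmaps : ∀ x ∈ (A + B).eigenspace z, A x ∈ (A + B).eigenspace z := by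
    intro x hx
    rw [Module.End.mem_eigenspace_iff] at hx ⊢
    have hc : Commute (A + B) A := (Commute.refl A).add_left hAB.symm
    have := congrArg (fun T : Module.End ℂ V => T x) hc.eq
    simp only [Module.End.mul_apply] at this
    rw [this, hx, map_smul]
  -- `A` has an eigenvector inside the `z`-eigenspace of `A + B`; it is then a common eigenvector,
  -- with `B`-eigenvalue `z - a`.
  have : Nontrivial ((A + B).eigenspace z) := Submodule.nontrivial_iff_ne_bot.mpr hz
  obtain ⟨a, ha⟩ := Module.End.exists_eigenvalue (A.restrict hmaps)
  obtain ⟨⟨v, hv⟩, hv'⟩ := ha.exists_hasEigenvector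
  have hv0 : v ≠ 0 := fun h => hv'.2 (Subtype.ext h)
  have hAv : A v = a • v := congrArg Subtype.val hv'.apply_eq_smul
  have hBv : B v = (z - a) • v := by
    have h := Module.End.mem_eigenspace_iff.mp hv
    rw [LinearMap.add_apply, hAv] at h
    rw [sub_smul, ← h, add_sub_cancel_left]
  have h1 := hA a (Module.End.hasEigenvalue_of_hasEigenvector
    ⟨Module.End.mem_eigenspace_iff.mpr hAv, hv0⟩)
  have h2 := hB (z - a) (Module.End.hasEigenvalue_of_hasEigenvector
    ⟨Module.End.mem_eigenspace_iff.mpr hBv, hv0⟩)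
  rw [Complex.sub_re] at h2
  linarith

theorem re_pos_of_hasEigenvalue_sum {V κ : Type*} [AddCommGroup V] [Module ℂ V]
    [FiniteDimensional ℂ V] {D : κ → Module.End ℂ V} (hD : ∀ i j, Commute (D i) (D j))
    (hpos : ∀ i z, (D i).HasEigenvalue z → 0 < z.re) {s : Finset κ} (hs : s.Nonempty) :
    ∀ z, (∑ i ∈ s, D i).HasEigenvalue z → 0 < z.re := by
  induction hs using Finset.Nonempty.cons_induction with
  | singleton i => simpa using hpos i
  | cons i s hi hs ih =>
    intro z hz
    rw [Finset.sum_cons] at hz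
    exact re_pos_of_hasEigenvalue_add (Commute.sum_right _ _ _ fun j _ => hD i j) (hpos i) ih hz

variable {α : Type*} [Fintype α]

/-- The action of `Xᵀ` on the `k`-th index of a tensor. -/
def slotMap (X : Matrix α α ℂ) {m : ℕ} (k : Fin m) : Module.End ℂ ((Fin m → α) → ℂ) where
  toFun f J := ∑ a, X a (J k) * f (Function.update J k a)
  map_add' f g := by
    ext J
    simp [mul_add, Finset.sum_add_distrib]
  map_smul' c f := by
    ext J
    simp only [Pi.smul_apply, smul_eq_mul, RingHom.id_apply, Finset.mul_sum]
    exact Finset.sum_congr rfl fun a _ => by ring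

theorem slotMap_apply (X : Matrix α α ℂ) {m : ℕ} (k : Fin m) (f : (Fin m → α) → ℂ)
    (J : Fin m → α) : slotMap X k f J = ∑ a, X a (J k) * f (Function.update J k a) := rfl

theorem commute_slotMap (X : Matrix α α ℂ) {m : ℕ} (i k : Fin m) :
    Commute (slotMap X i) (slotMap X k) := by
  rcases eq_or_ne i k with rfl | hik
  · exact Commute.refl _
  refine LinearMap.ext fun f => funext fun J => ?_
  simp only [Module.End.mul_apply, slotMap_apply, Function.update_of_ne hik,
    Function.update_of_ne hik.symm, Finset.mul_sum]
  rw [Finset.sum_comm]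
  refine Finset.sum_congr rfl fun a _ => Finset.sum_congr rfl fun b _ => ?_
  rw [Function.update_comm hik]
  ring

variable [DecidableEq α]

/-- Freezing all indices but the `k`-th at a point where the eigentensor is nonzero leaves a left
eigenvector of `X`. -/
theorem mem_spectrum_of_hasEigenvalue_slotMap {X : Matrix α α ℂ} {m : ℕ} {k : Fin m} {z : ℂ}
    (hz : (slotMap X k).HasEigenvalue z) : z ∈ spectrum ℂ X := by
  obtain ⟨f, hf⟩ := hz.exists_hasEigenvector
  obtain ⟨J, hJ⟩ : ∃ J, f J ≠ 0 := by
    by_contra! h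
    exact hf.2 (funext h)
  have hv : ∀ b, ∑ a, X a b * f (Function.update J k a) = z * f (Function.update J k b) := by
    intro b
    have := congrFun hf.apply_eq_smul (Function.update J k b)
    simpa [slotMap_apply] using this
  rw [spectrum.mem_iff, Matrix.isUnit_iff_isUnit_det, isUnit_iff_ne_zero, not_not,
    ← Matrix.exists_vecMul_eq_zero_iff]
  refine ⟨fun b => f (Function.update J k b), fun h => hJ ?_, ?_⟩
  · simpa using congrFun h (J k)
  · ext b
    rw [Matrix.vecMul_sub, Matrix.algebraMap_eq_diagonal, Pi.sub_apply, Matrix.vecMul_diagonal]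
    simp only [Matrix.vecMul, dotProduct, Pi.zero_apply, sub_eq_zero]
    rw [← (Finset.sum_congr rfl fun a _ => mul_comm _ _ : ∑ a, X a b * _ = _), hv b]
    simp [mul_comm]

/-- The Kronecker sum of `m ≥ 1` copies of a matrix with spectrum in the open right half plane is
injective. -/
theorem eq_zero_of_sum_slotMap_eq_zero {X : Matrix α α ℂ} (hX : ∀ z ∈ spectrum ℂ X, 0 < z.re)
    {m : ℕ} (hm : 0 < m) {f : (Fin m → α) → ℂ} (hf : ∑ k, slotMap X k f = 0) : f = 0 := by
  by_contra h
  have hne : (Finset.univ : Finset (Fin m)).Nonempty := ⟨⟨0, hm⟩, Finset.mem_univ _⟩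
  refine lt_irrefl (0 : ℝ) (re_pos_of_hasEigenvalue_sum (commute_slotMap X)
    (fun i z hz => hX z (mem_spectrum_of_hasEigenvalue_slotMap hz)) hne 0
    (Module.End.hasEigenvalue_of_hasEigenvector (x := f)
      ⟨Module.End.mem_eigenspace_iff.mpr ?_, h⟩))
  rw [LinearMap.sum_apply, hf, zero_smul]

/-- Uniqueness for the Lyapunov equation. -/
theorem eq_zero_of_transpose_mul_add_mul_eq_zero {X Z : Matrix α α ℂ}
    (hX : ∀ z ∈ spectrum ℂ X, 0 < z.re) (h : Xᵀ * Z + Z * X = 0) : Z = 0 := by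
  have key : (fun J : Fin 2 → α => Z (J 0) (J 1)) = 0 := by
    refine eq_zero_of_sum_slotMap_eq_zero hX two_pos (funext fun J => ?_)
    have := congrFun (congrFun h (J 0)) (J 1)
    rw [Fin.sum_univ_two, Pi.add_apply, slotMap_apply, slotMap_apply]
    simpa [Matrix.mul_apply, mul_comm] using this
  ext i j
  simpa using congrFun key ![i, j]

end CommutingOperators

/-! ### Clifford monomials modulo shorter ones -/

section Monomials

variable {α A : Type*} [Ring A] [Algebra ℂ A]

/-- The span of the monomials whose length is smaller than `m` and congruent to `m` mod `2`. -/
def lowerSpan (w : α → A) (m : ℕ) : Submodule ℂ A :=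
  Submodule.span ℂ {x | ∃ l : List α, (∃ i, l.length + 2 * (i + 1) = m) ∧ (l.map w).prod = x}

/-- The graded commutator of a monomial with a generator. -/
def gradedComm (w : α → A) (l : List α) (b : α) : A :=
  (l.map w).prod * w b - (-1 : ℂ) ^ l.length • (w b * (l.map w).prod)

variable {w : α → A}

theorem prod_mem_lowerSpan (w : α → A) (l : List α) :
    (l.map w).prod ∈ lowerSpan w (l.length + 2) :=
  Submodule.subset_span ⟨l, ⟨0, rfl⟩, rfl⟩

theorem mul_mem_lowerSpan {m : ℕ} {x : A} (hx : x ∈ lowerSpan w m) (a : α) :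
    w a * x ∈ lowerSpan w (m + 1) := by
  induction hx using Submodule.span_induction with
  | mem x hx =>
    obtain ⟨l, ⟨i, hi⟩, rfl⟩ := hx
    refine Submodule.subset_span ⟨a :: l, ⟨i, ?_⟩, by simp⟩
    rw [List.length_cons]
    omega
  | zero => simp
  | add x y _ _ hx hy => rw [mul_add]; exact add_mem hx hy
  | smul c x _ hx => rw [mul_smul_comm]; exact Submodule.smul_mem _ c hx

variable [DecidableEq α]

/-- The Clifford relations. -/
def IsClifford (w : α → A) : Prop :=
  ∀ j k, w j * w k + w k * w j = if j = k then (2 : ℂ) • (1 : A) else 0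

/-- The sum of the monomials obtained by replacing one factor `w b` by `w a`. -/
def replaceSum (w : α → A) (a b : α) : List α → A
  | [] => 0
  | j :: l => (if j = b then w a * (l.map w).prod else 0) + w j * replaceSum w a b l

theorem IsClifford.mul_self (hw : IsClifford w) (j : α) : w j * w j = 1 := by
  have h := hw j j
  rw [if_pos rfl, ← two_smul ℂ (w j * w j)] at h
  exact (IsUnit.mk0 (2 : ℂ) two_ne_zero).smul_left_cancel.mp h

theorem IsClifford.swap (hw : IsClifford w) (j k : α) :
    w j * w k = (if j = k then (2 : ℂ) • (1 : A) else 0) - w k * w j :=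
  eq_sub_of_add_eq (hw j k)

theorem gradedComm_cons (hw : IsClifford w) (j : α) (l : List α) (b : α) :
    gradedComm w (j :: l) b = w j * gradedComm w l b +
      ((-1 : ℂ) ^ l.length * (if j = b then 2 else 0)) • (l.map w).prod := by
  have h : (if j = b then (2 : ℂ) else 0) • (l.map w).prod =
      (w j * w b + w b * w j) * (l.map w).prod := by
    rw [hw j b]
    split_ifs <;> simp
  rw [mul_smul, h]
  simp only [gradedComm, List.map_cons, List.prod_cons, List.length_cons, pow_succ, mul_sub,
    add_mul, mul_smul_comm, mul_assoc]
  module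

/-- Anticommuting `w b` through the monomial leaves `±2` times the monomials with one factor `w b`
deleted. Their length is `l.length - 1`, which is why the level is `l.length + 1`. -/
theorem gradedComm_mem_lowerSpan (hw : IsClifford w) (l : List α) (b : α) :
    gradedComm w l b ∈ lowerSpan w (l.length + 1) := by
  induction l with
  | nil => simp [gradedComm]
  | cons j l ih =>
    rw [gradedComm_cons hw]
    exact add_mem (mul_mem_lowerSpan ih j) (Submodule.smul_mem _ _ (prod_mem_lowerSpan w l))

/-- The graded commutator deletes a factor `w b`; carrying the leading `w a` into the vacated slot
costs a sign and terms shorter by two. -/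
theorem mul_gradedComm_mem_lowerSpan (hw : IsClifford w) (a b : α) (l : List α) :
    (-1 : ℂ) ^ l.length • (w a * gradedComm w l b) + (2 : ℂ) • replaceSum w a b l ∈
      lowerSpan w l.length := by
  induction l with
  | nil => simp [gradedComm, replaceSum]
  | cons j l ih =>
    have h1 := mul_mem_lowerSpan ih j
    have h2 := Submodule.smul_mem _ ((-1 : ℂ) ^ (l.length + 1) * if a = j then (2 : ℂ) else 0)
      (gradedComm_mem_lowerSpan hw l b)
    have hsq : (-1 : ℂ) ^ l.length * (-1 : ℂ) ^ l.length = 1 := by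
      rw [← mul_pow]; simp
    rw [List.length_cons]
    convert add_mem h1 h2 using 1
    have h3 : w a * (w j * gradedComm w l b) =
        (if a = j then (2 : ℂ) else 0) • gradedComm w l b - w j * (w a * gradedComm w l b) := by
      rw [← mul_assoc, hw.swap a j, sub_mul, mul_assoc]
      split_ifs <;> simp
    have h4 : (if j = b then w a * (l.map w).prod else 0) =
        (if j = b then (1 : ℂ) else 0) • (w a * (l.map w).prod) := by
      split_ifs <;> simp
    have h5 : (if j = b then (2 : ℂ) else 0) = 2 * (if j = b then (1 : ℂ) else 0) := by
      split_ifs <;> simp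
    rw [gradedComm_cons hw, mul_add, h3, replaceSum, h4, h5, pow_succ]
    simp only [mul_add, mul_smul_comm]
    generalize (if j = b then (1 : ℂ) else 0) = d
    generalize (if a = j then (2 : ℂ) else 0) = e
    generalize (-1 : ℂ) ^ l.length = s at *
    linear_combination (norm := module) (-2 * d * hsq) • (w a * (l.map w).prod)

theorem gradedComm_mul_mem_lowerSpan (hw : IsClifford w) (a b : α) (l : List α) :
    gradedComm w l a * w b - (2 : ℂ) • replaceSum w b a l ∈ lowerSpan w l.length := by
  induction l with
  | nil => simp [gradedComm, replaceSum]
  | cons j l ih =>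
    have h1 := mul_mem_lowerSpan ih j
    have h2 := Submodule.smul_mem _ ((-1 : ℂ) ^ l.length * if j = a then (2 : ℂ) else 0)
      (gradedComm_mem_lowerSpan hw l b)
    have hsq : (-1 : ℂ) ^ l.length * (-1 : ℂ) ^ l.length = 1 := by
      rw [← mul_pow]; simp
    rw [List.length_cons]
    convert add_mem h1 h2 using 1
    have h3 : (l.map w).prod * w b =
        gradedComm w l b + (-1 : ℂ) ^ l.length • (w b * (l.map w).prod) := by
      simp [gradedComm]
    have h4 : (if j = a then w b * (l.map w).prod else 0) =
        (if j = a then (1 : ℂ) else 0) • (w b * (l.map w).prod) := by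
      split_ifs <;> simp
    have h5 : (if j = a then (2 : ℂ) else 0) = 2 * (if j = a then (1 : ℂ) else 0) := by
      split_ifs <;> simp
    rw [gradedComm_cons hw, add_mul, smul_mul_assoc, h3, replaceSum, h4, h5]
    simp only [mul_sub, mul_smul_comm, mul_assoc]
    generalize (if j = a then (1 : ℂ) else 0) = d
    generalize (-1 : ℂ) ^ l.length = s at *
    linear_combination (norm := module) (2 * d * hsq) • (w b * (l.map w).prod)

theorem commutator_quadratic_monomial (hw : IsClifford w) (a b : α) (l : List α) :
    w a * w b * (l.map w).prod - (l.map w).prod * (w a * w b) =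
      (2 : ℂ) • replaceSum w a b l - (2 : ℂ) • replaceSum w b a l := by
  induction l with
  | nil => simp [replaceSum]
  | cons j l ih =>
    have hj : w a * w b * w j - w j * (w a * w b) =
        (if j = b then (2 : ℂ) • w a else 0) - (if j = a then (2 : ℂ) • w b else 0) := by
      have h1 : w a * w b * w j = w a * (w b * w j + w j * w b) - (w a * w j + w j * w a) * w b +
          w j * (w a * w b) := by noncomm_ring
      rw [h1, hw, hw, add_sub_cancel_right]
      simp only [eq_comm (a := a), eq_comm (a := b)]
      split_ifs <;> simp
    calc _ = (w a * w b * w j - w j * (w a * w b)) * (l.map w).prod +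
          w j * (w a * w b * (l.map w).prod - (l.map w).prod * (w a * w b)) := by
            rw [List.map_cons, List.prod_cons]; noncomm_ring
      _ = _ := by
        rw [hj, ih, replaceSum, replaceSum]
        simp only [sub_mul, mul_sub, smul_add, mul_smul_comm, ite_mul, smul_mul_assoc, zero_mul,
          smul_ite, smul_zero]
        abel

/-- Bridge between the algebra and `slotMap`: the derivation extending `Y` acts slot by slot. -/
theorem sum_replaceSum_ofFn [Fintype α] (w : α → A) (Y : Matrix α α ℂ) {m : ℕ} (J : Fin m → α) :
    ∑ a, ∑ b, Y a b • replaceSum w a b (List.ofFn J) =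
      ∑ k, ∑ a, Y a (J k) • ((List.ofFn (Function.update J k a)).map w).prod := by
  induction m with
  | zero => simp [replaceSum]
  | succ m ih =>
    have hJ := ih (Fin.tail J)
    have hupd : ∀ (k : Fin m) (a : α), List.ofFn (Function.update J k.succ a) =
        J 0 :: List.ofFn (Function.update (Fin.tail J) k a) := by
      intro k a
      rw [List.ofFn_succ]
      refine congrArg₂ List.cons ?_ (congrArg List.ofFn (funext fun i => ?_))
      · exact Function.update_of_ne (Fin.succ_ne_zero k).symm _ _
      · rcases eq_or_ne i k with rfl | h
        · simp
        · simp [Function.update_of_ne h, Function.update_of_ne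
            (fun h' => h (Fin.succ_injective _ h') : i.succ ≠ k.succ), Fin.tail]
    have h0 : ∀ a : α, List.ofFn (Function.update J 0 a) = a :: List.ofFn (Fin.tail J) := by
      intro a
      rw [List.ofFn_succ]
      simp
      rfl
    have hcons : List.ofFn J = J 0 :: List.ofFn (Fin.tail J) := List.ofFn_succ
    rw [Fin.sum_univ_succ, hcons]
    simp only [hupd, h0, List.map_cons, List.prod_cons, replaceSum, smul_add,
      Finset.sum_add_distrib]
    congr 1
    · simp
    · simp only [← mul_smul_comm, ← Finset.mul_sum]
      rw [hJ]
      rfl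

end Monomials

/-! ### Trace orthogonality and completeness of monomials -/

section Spanning

theorem IsClifford.prod_mul {α A : Type*} [DecidableEq α] [Ring A] [Algebra ℂ A] {w : α → A}
    (hw : IsClifford w) (l : List α) (j : α) :
    (l.map w).prod * w j = (-1 : ℂ) ^ (l.length + l.count j) • (w j * (l.map w).prod) := by
  induction l with
  | nil => simp
  | cons a l ih =>
    rw [List.map_cons, List.prod_cons, mul_assoc, ih, mul_smul_comm, ← mul_assoc, hw.swap a j]
    rcases eq_or_ne a j with rfl | h
    · rw [if_pos rfl, hw.mul_self, List.count_cons_self, ← mul_assoc, hw.mul_self,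
        List.length_cons, add_add_add_comm, pow_add _ _ (1 + 1)]
      simp only [sub_mul, smul_mul_assoc, one_mul]
      module
    · rw [if_neg h, List.count_cons_of_ne h, List.length_cons, add_right_comm, pow_succ]
      simp [mul_assoc]

theorem IsClifford.prod_reverse_mul_prod {α A : Type*} [DecidableEq α] [Ring A] [Algebra ℂ A]
    {w : α → A} (hw : IsClifford w) (l : List α) :
    (l.reverse.map w).prod * (l.map w).prod = 1 := by
  induction l with
  | nil => simp
  | cons a l ih =>
    have : (l.reverse.map w).prod * w a * (w a * (l.map w).prod) =
        (l.reverse.map w).prod * (w a * w a) * (l.map w).prod := by noncomm_ring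
    simp only [List.reverse_cons, List.map_append, List.prod_append, List.map_cons, List.map_nil,
      List.prod_cons, List.prod_nil, mul_one]
    rw [this, hw.mul_self, mul_one, ih]

variable {ι α : Type*} [Fintype ι] [DecidableEq ι] [DecidableEq α] {w : α → Matrix ι ι ℂ}

/-- Here `w j` anticommutes with the product; inserting `w j * w j = 1` and using cyclicity shows
the trace equals its negative. -/
theorem IsClifford.trace_prod_eq_zero (hw : IsClifford w) {l : List α} {j : α}
    (h : Odd (l.length + l.count j)) : ((l.map w).prod).trace = 0 := by
  have h1 : ((l.map w).prod * (w j * w j)).trace = -((l.map w).prod * (w j * w j)).trace := by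
    conv_lhs => rw [← mul_assoc, hw.prod_mul, h.neg_one_pow, neg_smul, one_smul, neg_mul,
      Matrix.trace_neg, mul_assoc, Matrix.trace_mul_comm, mul_assoc]
  rw [hw.mul_self, mul_one] at h1
  exact self_eq_neg.mp h1

theorem count_toList_eq_ite (S : Finset α) (j : α) :
    S.toList.count j = if j ∈ S then 1 else 0 := by
  split_ifs with h
  · exact List.count_eq_one_of_mem S.nodup_toList (Finset.mem_toList.mpr h)
  · exact List.count_eq_zero_of_not_mem (fun h' => h (Finset.mem_toList.mp h'))

theorem IsClifford.trace_mul_eq_zero [Fintype α] (hw : IsClifford w) (hα : Even (Fintype.card α))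
    {S T : Finset α} (hST : S ≠ T) :
    ((S.toList.reverse.map w).prod * (T.toList.map w).prod).trace = 0 := by
  rw [← List.prod_append, ← List.map_append]
  suffices h : ∃ j, Odd (S.card + T.card + ((if j ∈ S then 1 else 0) + if j ∈ T then 1 else 0)) by
    obtain ⟨j, hj⟩ := h
    refine hw.trace_prod_eq_zero (j := j) ?_
    simpa [count_toList_eq_ite] using hj
  by_contra! hcon
  simp only [Nat.not_odd_iff_even] at hcon
  -- If no `j` works, membership in `S` and `T` agrees for every `j`, or disagrees for every `j`.
  -- The latter makes `T` the complement of `S`, with odd total size, against `hα`.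
  rcases Nat.even_or_odd (S.card + T.card) with he | ho
  · refine hST (Finset.ext fun j => ?_)
    have := (Nat.even_add.mp (hcon j)).mp he
    by_cases h1 : j ∈ S <;> by_cases h2 : j ∈ T <;> simp_all
  · have hc : T = Sᶜ := by
      ext j
      have := mt (Nat.even_add.mp (hcon j)).mpr (Nat.not_even_iff_odd.mpr ho)
      rw [Finset.mem_compl]
      by_cases h1 : j ∈ S <;> by_cases h2 : j ∈ T <;> simp_all
    rw [hc, Finset.card_add_card_compl] at ho
    exact Nat.not_even_iff_odd.mpr ho hα

theorem IsClifford.linearIndependent [Fintype α] [Nonempty ι] (hw : IsClifford w)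
    (hα : Even (Fintype.card α)) :
    LinearIndependent ℂ fun S : Finset α => (S.toList.map w).prod := by
  rw [Fintype.linearIndependent_iff]
  intro c hc S
  have h := congrArg (fun x => ((S.toList.reverse.map w).prod * x).trace) hc
  simp only [Finset.mul_sum, Matrix.trace_sum, mul_smul_comm, Matrix.trace_smul, mul_zero,
    Matrix.trace_zero] at h
  rw [Finset.sum_eq_single S (fun T _ hT => by rw [hw.trace_mul_eq_zero hα hT.symm, smul_zero])
    (fun h => absurd (Finset.mem_univ S) h), hw.prod_reverse_mul_prod, Matrix.trace_one] at h
  simpa using h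

theorem IsClifford.span_eq_top [Fintype α] {n : ℕ} (hw : IsClifford w)
    (hα : Fintype.card α = 2 * n) (hι : Fintype.card ι = 2 ^ n) :
    Submodule.span ℂ (Set.range fun l : List α => (l.map w).prod) = ⊤ := by
  have : Nonempty ι := Fintype.card_pos_iff.mp (by rw [hι]; positivity)
  -- The `2 ^ (2n)` subset monomials match the dimension `(2 ^ n) ^ 2`.
  have h := (hw.linearIndependent (by rw [hα]; exact even_two_mul n)).span_eq_top_of_card_eq_finrank'
    (by rw [Fintype.card_finset, Module.finrank_matrix, Module.finrank_self, hα, hι]; ring)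
  refine top_le_iff.mp (h ▸ Submodule.span_mono ?_)
  rintro _ ⟨S, rfl⟩
  exact ⟨S.toList, rfl⟩

theorem eq_zero_of_forall_trace_prod_mul_eq_zero [Fintype α] {n : ℕ} (hw : IsClifford w)
    (hα : Fintype.card α = 2 * n) (hι : Fintype.card ι = 2 ^ n) {ρ : Matrix ι ι ℂ}
    (h : ∀ l : List α, ((l.map w).prod * ρ).trace = 0) : ρ = 0 := by
  refine Matrix.ext_iff_trace_mul_left.mpr fun A => ?_
  rw [mul_zero, Matrix.trace_zero]
  have hA : A ∈ Submodule.span ℂ (Set.range fun l : List α => (l.map w).prod) := by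
    rw [hw.span_eq_top hα hι]; trivial
  induction hA using Submodule.span_induction with
  | mem x hx => obtain ⟨l, rfl⟩ := hx; exact h l
  | zero => simp
  | add x y _ _ hx hy => rw [add_mul, Matrix.trace_add, hx, hy, add_zero]
  | smul c x _ hx => rw [smul_mul_assoc, Matrix.trace_smul, hx, smul_zero]

end Spanning

/-! ### The adjoint generator on monomials -/

section Heisenberg

variable {ι κ : Type*} [Fintype ι] [Fintype κ]

/-- The adjoint of the Lindblad generator, acting on observables. -/
def heisenberg (h : Matrix ι ι ℂ) (L : κ → Matrix ι ι ℂ) (A : Matrix ι ι ℂ) : Matrix ι ι ℂ :=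
  Complex.I • (h * A - A * h) +
    ∑ μ, ((2 : ℂ) • ((L μ)ᴴ * A * L μ) - ((L μ)ᴴ * L μ * A + A * ((L μ)ᴴ * L μ)))

theorem trace_mul_liouvillean (h : Matrix ι ι ℂ) (L : κ → Matrix ι ι ℂ) (A ρ : Matrix ι ι ℂ) :
    (A * liouvillean h L ρ).trace = (heisenberg h L A * ρ).trace := by
  have hcyc : ∀ B : Matrix ι ι ℂ, (A * (ρ * B)).trace = (B * (A * ρ)).trace := fun B => by
    rw [← mul_assoc, Matrix.trace_mul_comm]
  simp only [liouvillean, heisenberg, mul_add, add_mul, Finset.mul_sum, Finset.sum_mul, mul_sub,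
    sub_mul, mul_smul_comm, smul_mul_assoc, Matrix.trace_add, Matrix.trace_sub, Matrix.trace_smul,
    Matrix.trace_sum, mul_assoc, smul_eq_mul]
  congr 1
  · rw [hcyc]
    ring
  · refine Finset.sum_congr rfl fun μ _ => ?_
    rw [← mul_assoc (L μ)ᴴ (L μ), hcyc, ← mul_assoc A (L μ), ← mul_assoc (A * L μ) ρ,
      Matrix.trace_mul_comm (A * L μ * ρ)]
    simp only [mul_assoc]
    ring

variable {n : ℕ} {w : Fin (2 * n) → Matrix ι ι ℂ}

theorem sum_conjTranspose_mul_mul (hw : ∀ j, (w j).IsHermitian) (l : κ → Fin (2 * n) → ℂ)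
    (A : Matrix ι ι ℂ) :
    ∑ μ, (lindbladOp w (l μ))ᴴ * A * lindbladOp w (l μ) =
      ∑ a, ∑ b, bathMatrix l b a • (w a * A * w b) := by
  have : ∀ μ, (lindbladOp w (l μ))ᴴ * A * lindbladOp w (l μ) =
      ∑ a, ∑ b, (l μ b * star (l μ a)) • (w a * A * w b) := by
    intro μ
    simp only [lindbladOp, Matrix.conjTranspose_sum, Matrix.conjTranspose_smul, (hw _).eq,
      Finset.sum_mul, Finset.mul_sum, smul_mul_assoc, mul_smul_comm, Finset.smul_sum, smul_smul]
    rw [Finset.sum_comm]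
  simp only [this, bathMatrix, Matrix.of_apply, Finset.sum_smul]
  rw [Finset.sum_comm]
  exact Finset.sum_congr rfl fun a _ => Finset.sum_comm

theorem heisenberg_quadratic [DecidableEq ι] (hw : ∀ j, (w j).IsHermitian)
    (H : Matrix (Fin (2 * n)) (Fin (2 * n)) ℂ)
    (l : κ → Fin (2 * n) → ℂ) (A : Matrix ι ι ℂ) :
    heisenberg (hamiltonian w H) (fun μ => lindbladOp w (l μ)) A =
      ∑ a, ∑ b, ((Complex.I * H a b) • (w a * w b * A - A * (w a * w b)) + bathMatrix l b a •
        ((2 : ℂ) • (w a * A * w b) - (w a * w b * A + A * (w a * w b)))) := by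
  have h1 := sum_conjTranspose_mul_mul hw l A
  have h2 := sum_conjTranspose_mul_mul hw l 1
  simp only [mul_one] at h2
  simp only [heisenberg, hamiltonian, Finset.sum_add_distrib, Finset.sum_sub_distrib, smul_sub,
    smul_add, ← Finset.smul_sum, ← Finset.sum_mul, ← Finset.mul_sum, h1, h2, mul_smul,
    smul_comm _ (2 : ℂ)]
  simp only [Finset.sum_mul, Finset.mul_sum, smul_mul_assoc, mul_smul_comm]

theorem bathMatrix_map_star (l : κ → Fin (2 * n) → ℂ) :
    (bathMatrix l).map star = (bathMatrix l)ᵀ := by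
  ext i j
  simp [bathMatrix, mul_comm]

theorem rapidityMatrix_apply (H : Matrix (Fin (2 * n)) (Fin (2 * n)) ℂ) (l : κ → Fin (2 * n) → ℂ)
    (a b : Fin (2 * n)) : rapidityMatrix H l a b =
      -2 * Complex.I * H a b + (bathMatrix l a b + bathMatrix l b a) := by
  simp only [rapidityMatrix, bathRe, bathMatrix_map_star, Matrix.add_apply, Matrix.smul_apply,
    Matrix.transpose_apply, smul_eq_mul]
  ring

/-- Up to shorter monomials, the adjoint generator acts on monomials as a derivation. -/
theorem heisenberg_monomial [DecidableEq ι] (hw : IsMajoranaFamily w)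
    {H : Matrix (Fin (2 * n)) (Fin (2 * n)) ℂ} (hH : Hᵀ = -H) (l : κ → Fin (2 * n) → ℂ)
    (J : List (Fin (2 * n))) {P : Matrix ι ι ℂ}
    (hP : ∀ j, P * w j = (-1 : ℂ) ^ J.length • (w j * P)) :
    ∃ x ∈ lowerSpan w J.length,
      heisenberg (hamiltonian w H) (fun μ => lindbladOp w (l μ)) ((J.map w).prod * P) =
        (x - (2 : ℂ) • ∑ a, ∑ b, rapidityMatrix H l a b • replaceSum w a b J) * P := by
  have hc : IsClifford w := hw.2
  have hs : (-1 : ℂ) ^ J.length * (-1 : ℂ) ^ J.length = 1 := by rw [← mul_pow]; simp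
  have hH' : ∀ a b, H b a = -H a b := fun a b => congrFun (congrFun hH a) b
  refine ⟨∑ a, ∑ b, bathMatrix l b a • (((-1 : ℂ) ^ J.length • (w a * gradedComm w J b) +
    (2 : ℂ) • replaceSum w a b J) - (gradedComm w J a * w b - (2 : ℂ) • replaceSum w b a J)),
    Submodule.sum_mem _ fun a _ => Submodule.sum_mem _ fun b _ => Submodule.smul_mem _ _
      (sub_mem (mul_gradedComm_mem_lowerSpan hc a b J) (gradedComm_mul_mem_lowerSpan hc a b J)), ?_⟩
  have hPP : ∀ a b, (J.map w).prod * P * (w a * w b) = (J.map w).prod * (w a * w b) * P := by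
    intro a b
    have : P * (w a * w b) = w a * w b * P := by
      rw [← mul_assoc, hP, smul_mul_assoc, mul_assoc, hP, mul_smul_comm, smul_smul, hs, one_smul,
        mul_assoc]
    rw [mul_assoc, this, mul_assoc (J.map w).prod]
  have hcomm : ∀ a b, w a * w b * ((J.map w).prod * P) - (J.map w).prod * P * (w a * w b) =
      ((2 : ℂ) • replaceSum w a b J - (2 : ℂ) • replaceSum w b a J) * P := by
    intro a b
    rw [hPP, ← commutator_quadratic_monomial hc]
    noncomm_ring
  have hdiss : ∀ a b, (2 : ℂ) • (w a * ((J.map w).prod * P) * w b) -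
      (w a * w b * ((J.map w).prod * P) + (J.map w).prod * P * (w a * w b)) =
      ((-1 : ℂ) ^ J.length • (w a * gradedComm w J b) - gradedComm w J a * w b) * P := by
    intro a b
    have h2 : w a * ((J.map w).prod * P) * w b =
        (-1 : ℂ) ^ J.length • (w a * ((J.map w).prod * (w b * P))) := by
      rw [mul_assoc, mul_assoc (J.map w).prod, hP, mul_smul_comm, mul_smul_comm]
    rw [hPP, h2]
    simp only [gradedComm, mul_sub, sub_mul, smul_sub, mul_smul_comm, smul_mul_assoc, smul_smul,
      hs, one_smul, mul_assoc]
    module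
  rw [heisenberg_quadratic hw.1]
  simp only [hcomm, hdiss]
  simp only [← smul_mul_assoc, ← add_mul, ← Finset.sum_mul]
  congr 1
  have hswap : ∀ f : Matrix (Fin (2 * n)) (Fin (2 * n)) ℂ,
      ∑ a, ∑ b, f a b • replaceSum w b a J = ∑ a, ∑ b, f b a • replaceSum w a b J :=
    fun f => Finset.sum_comm
  -- Relabelling turns every `replaceSum w b a` into `replaceSum w a b`: antisymmetry of `H` doubles
  -- the Hamiltonian part, and the bath part becomes `M + Mᵀ`.
  have e1 := hswap fun a b => -(2 * Complex.I * H a b) - 2 * bathMatrix l b a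
  rw [← sub_eq_zero] at e1 ⊢
  rw [← e1]
  simp only [Finset.smul_sum, ← Finset.sum_sub_distrib,
    rapidityMatrix_apply]
  refine Finset.sum_congr rfl fun a _ => Finset.sum_congr rfl fun b _ => ?_
  rw [hH' a b]
  module

end Heisenberg

/-! ### Existence and uniqueness of the steady state -/

section SteadyState

variable {ι κ : Type*} [Fintype ι] [DecidableEq ι] [Fintype κ] {n : ℕ}
  {w : Fin (2 * n) → Matrix ι ι ℂ} {H : Matrix (Fin (2 * n)) (Fin (2 * n)) ℂ}
  {l : κ → Fin (2 * n) → ℂ} {ρ : Matrix ι ι ℂ}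

/-- Lengths of one parity form a closed hierarchy: once shorter traces vanish, stationarity says
that the Kronecker sum annihilates the tensor of traces of length `m`. The factor `P` is `1` for
even lengths and the parity operator for odd ones; length zero occurs only when `s = 1`. -/
theorem trace_prod_mul_mul_eq_zero (hw : IsMajoranaFamily w) (hH : Hᵀ = -H)
    (hX : ∀ z ∈ spectrum ℂ (rapidityMatrix H l), 0 < z.re)
    (hρ : liouvillean (hamiltonian w H) (fun μ => lindbladOp w (l μ)) ρ = 0)
    {P : Matrix ι ι ℂ} {s : ℂ} (hP : ∀ j, P * w j = s • (w j * P))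
    (hP1 : s = 1 → (P * ρ).trace = 0) (m : ℕ) (hm : (-1 : ℂ) ^ m = s) :
    ∀ J : List (Fin (2 * n)), J.length = m → ((J.map w).prod * P * ρ).trace = 0 := by
  induction m using Nat.strong_induction_on with
  | _ m ih =>
  rcases Nat.eq_zero_or_pos m with rfl | hm0
  · intro J hJ
    rw [List.length_eq_zero_iff.mp hJ]
    simpa using hP1 (by rw [← hm, pow_zero])
  have hlow : ∀ x ∈ lowerSpan w m, (x * P * ρ).trace = 0 := by
    intro x hx
    induction hx using Submodule.span_induction with
    | mem x hx =>
      obtain ⟨J, ⟨i, hi⟩, rfl⟩ := hx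
      refine ih J.length (by omega) ?_ J rfl
      rw [← hm, ← hi, pow_add, pow_mul]
      simp
    | zero => simp
    | add x y _ _ hx hy => simp only [add_mul, Matrix.trace_add, hx, hy, add_zero]
    | smul c x _ hx => simp only [smul_mul_assoc, Matrix.trace_smul, hx, smul_zero]
  have key : (fun J : Fin m → Fin (2 * n) => (((List.ofFn J).map w).prod * P * ρ).trace) = 0 := by
    refine eq_zero_of_sum_slotMap_eq_zero hX hm0 (funext fun J => ?_)
    obtain ⟨x, hx, hx'⟩ := heisenberg_monomial hw hH l (List.ofFn J) (P := P)
      (by simpa [hm] using hP)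
    rw [List.length_ofFn] at hx
    have h := trace_mul_liouvillean (hamiltonian w H) (fun μ => lindbladOp w (l μ))
      (((List.ofFn J).map w).prod * P) ρ
    rw [hρ, mul_zero, Matrix.trace_zero, hx', sub_mul, sub_mul, Matrix.trace_sub, hlow x hx,
      sum_replaceSum_ofFn, zero_sub, eq_comm, neg_eq_zero, smul_mul_assoc, smul_mul_assoc,
      Matrix.trace_smul, smul_eq_zero_iff_right two_ne_zero] at h
    simpa only [Finset.sum_mul, Matrix.trace_sum, smul_mul_assoc, Matrix.trace_smul, smul_eq_mul,
      Finset.sum_apply, slotMap_apply, Pi.zero_apply] using h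
  intro J hJ
  subst hJ
  simpa using congrFun key J.get

/-- The generator is injective on traceless operators. -/
theorem eq_zero_of_liouvillean_eq_zero (hι : Fintype.card ι = 2 ^ n) (hw : IsMajoranaFamily w)
    (hH : Hᵀ = -H) (hX : ∀ z ∈ spectrum ℂ (rapidityMatrix H l), 0 < z.re)
    (hρ : liouvillean (hamiltonian w H) (fun μ => lindbladOp w (l μ)) ρ = 0)
    (htr : ρ.trace = 0) : ρ = 0 := by
  have hc : IsClifford w := hw.2
  refine eq_zero_of_forall_trace_prod_mul_eq_zero hc (Fintype.card_fin _) hι fun J => ?_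
  rcases Nat.even_or_odd J.length with he | ho
  · have := trace_prod_mul_mul_eq_zero hw hH hX hρ (P := 1) (s := 1) (by simp) (by simp [htr])
      J.length he.neg_one_pow J rfl
    rwa [mul_one] at this
  · set U : List (Fin (2 * n)) := Finset.univ.toList
    have hU : U.length = 2 * n := by simp [U]
    have hcount : ∀ j, U.count j = 1 := fun j => by
      rw [count_toList_eq_ite, if_pos (Finset.mem_univ j)]
    have hP : ∀ j, (U.map w).prod * w j = (-1 : ℂ) • (w j * (U.map w).prod) := by
      intro j
      rw [hc.prod_mul, hU, hcount, pow_add, pow_mul]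
      simp
    -- Appending `U.reverse` cancels the parity operator on the right and keeps the length odd.
    have := trace_prod_mul_mul_eq_zero hw hH hX hρ hP (fun h => by norm_num at h)
      (J ++ U.reverse).length
      (by rw [List.length_append, List.length_reverse, hU, pow_add, pow_mul, ho.neg_one_pow]; simp)
      _ rfl
    rwa [List.map_append, List.prod_append, mul_assoc (List.prod _), hc.prod_reverse_mul_prod,
      mul_one] at this

theorem trace_liouvillean (h : Matrix ι ι ℂ) (L : κ → Matrix ι ι ℂ) (ρ : Matrix ι ι ℂ) :
    (liouvillean h L ρ).trace = 0 := by
  have := trace_mul_liouvillean h L 1 ρ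
  rw [one_mul] at this
  rw [this]
  simp [heisenberg, two_smul]

/-- The generator plus `ρ ↦ tr ρ • 1`. -/
def liouvilleanAddTrace (h : Matrix ι ι ℂ) (L : κ → Matrix ι ι ℂ) :
    Module.End ℂ (Matrix ι ι ℂ) where
  toFun ρ := liouvillean h L ρ + ρ.trace • 1
  map_add' x y := by
    simp only [liouvillean, mul_add, add_mul, Matrix.trace_add, add_smul, smul_add, smul_sub,
      Finset.sum_add_distrib, Finset.sum_sub_distrib]
    abel
  map_smul' c x := by
    simp only [liouvillean, mul_smul_comm, smul_mul_assoc, Matrix.trace_smul, RingHom.id_apply,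
      smul_add, Finset.smul_sum, ← smul_sub, smul_eq_mul, mul_smul, smul_comm c]
    congr 2
    exact Finset.sum_congr rfl fun μ _ => by module

theorem existsUnique_isNESS (hι : Fintype.card ι = 2 ^ n) (hw : IsMajoranaFamily w)
    (hH : Hᵀ = -H) (hX : ∀ z ∈ spectrum ℂ (rapidityMatrix H l), 0 < z.re) :
    ∃! ρ : Matrix ι ι ℂ, IsNESS w H l ρ := by
  have htrace : ∀ σ : Matrix ι ι ℂ, (liouvilleanAddTrace (hamiltonian w H)
      (fun μ => lindbladOp w (l μ)) σ).trace = σ.trace * 2 ^ n := by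
    intro σ
    simp [liouvilleanAddTrace, trace_liouvillean, hι]
  have hinj : Function.Injective (liouvilleanAddTrace (hamiltonian w H)
      (fun μ => lindbladOp w (l μ))) := by
    -- Since the generator has traceless image, taking traces separates the two summands: a kernel
    -- element is traceless and stationary.
    refine (injective_iff_map_eq_zero _).mpr fun σ hσ => ?_
    have h0 : σ.trace = 0 := by
      have := htrace σ
      rw [hσ, Matrix.trace_zero] at this
      simpa using this.symm
    refine eq_zero_of_liouvillean_eq_zero hι hw hH hX ?_ h0
    simpa [liouvilleanAddTrace, h0] using hσ
  have hiff : ∀ σ : Matrix ι ι ℂ, IsNESS w H l σ ↔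
      liouvilleanAddTrace (hamiltonian w H) (fun μ => lindbladOp w (l μ)) σ = 1 := by
    refine fun σ => ⟨fun h => ?_, fun h => ?_⟩
    · simp [liouvilleanAddTrace, h.1, h.2]
    · have h1 : σ.trace = 1 := by
        have := htrace σ
        rw [h, Matrix.trace_one, hι] at this
        push_cast at this
        exact (mul_eq_right₀ (pow_ne_zero n two_ne_zero)).mp this.symm
      exact ⟨by simpa [liouvilleanAddTrace, h1] using h, h1⟩
  obtain ⟨σ, hσ⟩ := LinearMap.injective_iff_surjective.mp hinj 1
  exact ⟨σ, (hiff σ).mpr hσ, fun τ hτ => hinj (((hiff τ).mp hτ).trans hσ.symm)⟩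

end SteadyState

/-! ### The Lyapunov equation and the symmetries of its solution -/

section Lyapunov

theorem existsUnique_lyapunov {α : Type*} [Fintype α] [DecidableEq α] {X : Matrix α α ℂ}
    (hX : ∀ z ∈ spectrum ℂ X, 0 < z.re) (Y : Matrix α α ℂ) : ∃! Z, Xᵀ * Z + Z * X = Y := by
  have hinj : Function.Injective (LinearMap.mulLeft ℂ Xᵀ + LinearMap.mulRight ℂ X) :=
    (injective_iff_map_eq_zero _).mpr fun Z hZ => eq_zero_of_transpose_mul_add_mul_eq_zero hX hZ
  obtain ⟨Z, hZ⟩ := LinearMap.injective_iff_surjective.mp hinj Y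
  exact ⟨Z, hZ, fun Z' hZ' => hinj (Eq.trans hZ' hZ.symm)⟩

variable {κ : Type*} [Fintype κ] {n : ℕ} {H Z : Matrix (Fin (2 * n)) (Fin (2 * n)) ℂ}
  {l : κ → Fin (2 * n) → ℂ}

theorem bathIm_eq (l : κ → Fin (2 * n) → ℂ) :
    bathIm l = (-(Complex.I / 2)) • (bathMatrix l - (bathMatrix l)ᵀ) := by
  rw [bathIm, bathMatrix_map_star]
  congr 1
  rw [one_div, mul_inv, Complex.inv_I]
  ring

theorem rapidityMatrix_eq (H : Matrix (Fin (2 * n)) (Fin (2 * n)) ℂ) (l : κ → Fin (2 * n) → ℂ) :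
    rapidityMatrix H l = (-2 * Complex.I) • H + (bathMatrix l + (bathMatrix l)ᵀ) := by
  ext a b
  simp [rapidityMatrix_apply]

theorem bathMatrix_conjTranspose (l : κ → Fin (2 * n) → ℂ) : (bathMatrix l)ᴴ = bathMatrix l := by
  ext i j
  simp [bathMatrix, mul_comm]

theorem bathMatrix_transpose_conjTranspose (l : κ → Fin (2 * n) → ℂ) :
    (bathMatrix l)ᵀᴴ = (bathMatrix l)ᵀ := by
  ext i j
  simp [bathMatrix, mul_comm]

theorem rapidityMatrix_conjTranspose (hH : H.IsHermitian) (hH' : Hᵀ = -H) :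
    (rapidityMatrix H l)ᴴ = (rapidityMatrix H l)ᵀ := by
  simp [rapidityMatrix_eq, hH.eq, hH', bathMatrix_transpose_conjTranspose, bathMatrix_conjTranspose, add_comm]

/-- Transposing preserves the left side and negates `bathIm`, so `Zᵀ + Z` solves the homogeneous
equation. The adjoint version below is the same, because `X` is real. -/
theorem IsLyapunovSolution.transpose_eq_neg (hX : ∀ z ∈ spectrum ℂ (rapidityMatrix H l), 0 < z.re)
    (hZ : IsLyapunovSolution H l Z) : Zᵀ = -Z := by
  refine eq_neg_of_add_eq_zero_left (eq_zero_of_transpose_mul_add_mul_eq_zero hX ?_)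
  have h1 : (rapidityMatrix H l)ᵀ * Z + Z * rapidityMatrix H l = bathIm l := hZ
  have h2 := congrArg Matrix.transpose h1
  have h3 : (bathIm l)ᵀ = -bathIm l := by
    rw [bathIm_eq]
    simp [← smul_neg]
  simp only [Matrix.transpose_add, Matrix.transpose_mul, Matrix.transpose_transpose, h3] at h2
  rw [mul_add, add_mul, add_add_add_comm, h1, add_comm (_ * Zᵀ), h2, neg_add_cancel]

theorem IsLyapunovSolution.conjTranspose_eq_neg (hH : H.IsHermitian) (hH' : Hᵀ = -H)
    (hX : ∀ z ∈ spectrum ℂ (rapidityMatrix H l), 0 < z.re)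
    (hZ : IsLyapunovSolution H l Z) : Zᴴ = -Z := by
  refine eq_neg_of_add_eq_zero_left (eq_zero_of_transpose_mul_add_mul_eq_zero hX ?_)
  have h1 : (rapidityMatrix H l)ᵀ * Z + Z * rapidityMatrix H l = bathIm l := hZ
  have h2 := congrArg Matrix.conjTranspose h1
  have h3 : (bathIm l)ᴴ = -bathIm l := by
    rw [bathIm_eq]
    simp [bathMatrix_conjTranspose, bathMatrix_transpose_conjTranspose, neg_div]
  have h4 : (rapidityMatrix H l)ᵀᴴ = rapidityMatrix H l := by
    rw [← rapidityMatrix_conjTranspose hH hH', Matrix.conjTranspose_conjTranspose]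
  simp only [Matrix.conjTranspose_add, Matrix.conjTranspose_mul, h3, h4,
    rapidityMatrix_conjTranspose hH hH'] at h2
  rw [mul_add, add_mul, add_add_add_comm, h1, add_comm (_ * Zᴴ), h2, neg_add_cancel]

end Lyapunov

/-! ### Two-point functions -/

section Covariance

variable {ι κ : Type*} [Fintype ι] [DecidableEq ι] [Fintype κ] {n : ℕ}
  {w : Fin (2 * n) → Matrix ι ι ℂ} {H : Matrix (Fin (2 * n)) (Fin (2 * n)) ℂ}
  {l : κ → Fin (2 * n) → ℂ} {ρ : Matrix ι ι ℂ}

/-- The matrix of two-point functions of `ρ`. -/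
def covariance (w : Fin (2 * n) → Matrix ι ι ℂ) (ρ : Matrix ι ι ℂ) :
    Matrix (Fin (2 * n)) (Fin (2 * n)) ℂ :=
  Matrix.of fun j k => (w j * w k * ρ).trace

theorem covariance_transpose (hw : IsMajoranaFamily w) (hρ : ρ.trace = 1) :
    (covariance w ρ)ᵀ = (2 : ℂ) • 1 - covariance w ρ := by
  ext j k
  have h := congrArg (fun x => (x * ρ).trace) (hw.2 k j)
  simp only [add_mul, Matrix.trace_add] at h
  simp only [covariance, Matrix.transpose_apply, Matrix.of_apply, Matrix.sub_apply,
    Matrix.smul_apply, Matrix.one_apply]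
  rw [eq_sub_iff_add_eq, h]
  rcases eq_or_ne j k with rfl | hjk
  · simp [hρ]
  · simp [hjk, hjk.symm]

theorem heisenberg_pair (hw : IsMajoranaFamily w) (H : Matrix (Fin (2 * n)) (Fin (2 * n)) ℂ)
    (l : κ → Fin (2 * n) → ℂ) (j k : Fin (2 * n)) :
    heisenberg (hamiltonian w H) (fun μ => lindbladOp w (l μ)) (w j * w k) = (2 : ℂ) • ∑ a,
      (Complex.I • (H a j • (w a * w k) + H a k • (w j * w a) -
        (H j a • (w a * w k) + H k a • (w j * w a))) +
      (bathMatrix l k a • (w a * w j) - bathMatrix l j a • (w a * w k) -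
        bathMatrix l a k • (w j * w a) + bathMatrix l a j • (w k * w a))) := by
  have hc : IsClifford w := hw.2
  have hcomm := fun a b => commutator_quadratic_monomial hc a b [j, k]
  have hg : ∀ b, w j * w k * w b - w b * (w j * w k) =
      (if k = b then (2 : ℂ) • w j else 0) - if j = b then (2 : ℂ) • w k else 0 := by
    intro b
    have : w j * w k * w b - w b * (w j * w k) =
      w j * (w k * w b + w b * w k) - (w j * w b + w b * w j) * w k := by noncomm_ring
    rw [this, hw.2, hw.2]
    split_ifs <;> simp
  have hdiss : ∀ a b, (2 : ℂ) • (w a * (w j * w k) * w b) -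
      (w a * w b * (w j * w k) + w j * w k * (w a * w b)) =
      w a * (w j * w k * w b - w b * (w j * w k)) -
        (w j * w k * w a - w a * (w j * w k)) * w b := by
    intro a b
    rw [two_smul]
    noncomm_ring
  rw [heisenberg_quadratic hw.1]
  simp only [hdiss, hg]
  simp only [List.map_cons, List.map_nil, List.prod_cons, List.prod_nil, mul_one, replaceSum,
    mul_zero, add_zero] at hcomm
  simp only [hcomm, mul_sub, sub_mul, mul_ite, ite_mul, mul_zero, zero_mul, smul_add, smul_sub,
    smul_ite, smul_zero, Finset.sum_add_distrib, Finset.sum_sub_distrib, mul_smul_comm,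
    smul_mul_assoc, Finset.sum_ite_eq, Finset.mem_univ, if_true]
  have hrow : ∀ (i : Fin (2 * n)) (f : Fin (2 * n) → Fin (2 * n) → Matrix ι ι ℂ),
      (∑ a, ∑ b, if i = a then f a b else 0) = ∑ b, f i b := by
    intro i f
    rw [Finset.sum_comm]
    simp
  simp only [hrow]
  simp only [Finset.smul_sum, ← Finset.sum_add_distrib, ← Finset.sum_sub_distrib]
  refine Finset.sum_congr rfl fun a _ => ?_
  module

/-- Stationarity tested on `w j * w k` involves only two-point functions. The source term `bathIm`
comes from the constant in `covariance_transpose`; the factor `I / 4` inverts `C = 1 - 4iZ`. -/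
theorem isLyapunovSolution_covariance (hw : IsMajoranaFamily w) (hH : Hᵀ = -H)
    (hρ : IsNESS w H l ρ) :
    IsLyapunovSolution H l ((Complex.I / 4) • (covariance w ρ - 1)) := by
  have hC := covariance_transpose hw hρ.2
  have hE : (-4 * Complex.I) • (H * covariance w ρ) + (4 * Complex.I) • (covariance w ρ * H) +
      (2 : ℂ) • ((bathMatrix l * covariance w ρ)ᵀ - bathMatrix l * covariance w ρ -
        covariance w ρ * bathMatrix l + (covariance w ρ * bathMatrix l)ᵀ) = 0 := by
    ext j k
    have h := trace_mul_liouvillean (hamiltonian w H) (fun μ => lindbladOp w (l μ)) (w j * w k) ρ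
    rw [hρ.1, mul_zero, Matrix.trace_zero, heisenberg_pair hw] at h
    have hH' : ∀ a b, H b a = -H a b := fun a b => congrFun (congrFun hH a) b
    rw [Matrix.zero_apply, h]
    simp only [Matrix.add_apply, Matrix.sub_apply, Matrix.smul_apply, Matrix.transpose_apply,
      Matrix.mul_apply, smul_mul_assoc, Matrix.trace_smul, Finset.sum_mul, Matrix.trace_sum,
      add_mul, sub_mul, Matrix.trace_add, Matrix.trace_sub, covariance, Matrix.of_apply,
      smul_eq_mul, Finset.mul_sum, ← Finset.sum_add_distrib, ← Finset.sum_sub_distrib]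
    refine Finset.sum_congr rfl fun a _ => ?_
    rw [hH' j a, hH' a k]
    ring
  rw [Matrix.transpose_mul, Matrix.transpose_mul, hC] at hE
  unfold IsLyapunovSolution
  rw [rapidityMatrix_eq, bathIm_eq]
  simp only [Matrix.transpose_add, Matrix.transpose_smul, Matrix.transpose_transpose, hH, mul_add,
    add_mul, mul_sub, sub_mul, mul_smul_comm, smul_mul_assoc, mul_one, one_mul, smul_neg,
    neg_mul] at hE ⊢
  linear_combination (norm := module) (-(Complex.I / 8)) • hE

end Covariance

end QuadraticLindblad

theorem mainTheorem4 {ι κ : Type*} [Fintype ι] [DecidableEq ι] [Fintype κ] (n : ℕ)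
    (hι : Fintype.card ι = 2 ^ n)
    (w : Fin (2 * n) → Matrix ι ι ℂ) (hw : QuadraticLindblad.IsMajoranaFamily w)
    (H : Matrix (Fin (2 * n)) (Fin (2 * n)) ℂ)
    (hH : H.IsHermitian) (hH' : H.transpose = -H)
    (l : κ → Fin (2 * n) → ℂ)
    (hX : ∀ β ∈ spectrum ℂ (QuadraticLindblad.rapidityMatrix H l), 0 < β.re) :
    (∃! ρ : Matrix ι ι ℂ, QuadraticLindblad.IsNESS w H l ρ) ∧
    (∃! Z : Matrix (Fin (2 * n)) (Fin (2 * n)) ℂ,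
      QuadraticLindblad.IsLyapunovSolution H l Z) ∧
    ∀ (ρ : Matrix ι ι ℂ) (Z : Matrix (Fin (2 * n)) (Fin (2 * n)) ℂ),
      QuadraticLindblad.IsNESS w H l ρ → QuadraticLindblad.IsLyapunovSolution H l Z →
        Z.transpose = -Z ∧ (∀ j k, (Z j k).im = 0) ∧
        ∀ j k, (w j * w k * ρ).trace = (if j = k then 1 else 0) - 4 * Complex.I * Z j k := by
  have hZu := QuadraticLindblad.existsUnique_lyapunov hX (QuadraticLindblad.bathIm l)
  refine ⟨QuadraticLindblad.existsUnique_isNESS hι hw hH' hX, hZu, fun ρ Z hρ hZ => ?_⟩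
  have hT := hZ.transpose_eq_neg hX
  have hC := hZ.conjTranspose_eq_neg hH hH' hX
  refine ⟨hT, fun j k => ?_, fun j k => ?_⟩
  -- Adjoint and transpose both equal `-Z`, so each entry is its own conjugate.
  · have h := congrFun (congrFun (hC.trans hT.symm) k) j
    rw [Matrix.conjTranspose_apply, Matrix.transpose_apply] at h
    exact Complex.conj_eq_iff_im.mp h
  · rw [hZu.unique hZ (QuadraticLindblad.isLyapunovSolution_covariance hw hH' hρ)]
    simp only [QuadraticLindblad.covariance, Matrix.smul_apply, Matrix.sub_apply, Matrix.of_apply,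
      Matrix.one_apply, smul_eq_mul]
    linear_combination ((w j * w k * ρ).trace - if j = k then 1 else 0) * Complex.I_mul_I
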